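/- Let $\alpha,h,\ell,t,\varepsilon,r$ be integers with $\alpha\ge 2$, $h,\ell,t\ge 1$, $\varepsilon,r\ge 0$ and $h\le 2\ell+\varepsilon$, and let $q$ be a prime power. The generalized combination network $(\varepsilon,\ell)\text{-}\mathcal N_{h,r,\alpha\ell+\varepsilon}$ is the following three-layer multicast network: a source holds $h$ messages; there are $r$ middle nodes, each joined from the source by $\ell$ parallel links; for every set of $\alpha$ middle nodes there is exactly one receiver, joined by $\ell$ parallel links from each of these $\alpha$ nodes and by $\varepsilon$ direct links from the source. A $(q,t)$-linear solution of the network is an assignment in which the messages are vectors in $\mathbb F_q^t$, every link carries a vector in $\mathbb F_q^t$ that is an $\mathbb F_q$-linear function of the messages (for a link leaving the source) or of the vectors on the incoming links of the node it leaves (for a link leaving a middle node), and every receiver can recover all $h$ messages linearly from its incoming vectors. Put $$g(t)=\max\{\ell t,(h-\ell)t\}\cdot\bigl(\min\{\ell t,(h-\ell)t\}-(h-\ell-\varepsilon)t+1\bigr).$$ Then $$g(t)=\begin{cases}\ell\varepsilon t^2+\ell t & \text{if } h\le 2\ell,\\ (h-\ell)(2\ell+\varepsilon-h)t^2+(h-\ell)t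 & \text{otherwise,}\end{cases}$$ and if $r\le(\alpha-1)q^{g(t)}$, then the network $(\varepsilon,\ell)\text{-}\mathcal N_{h,r,\alpha\ell+\varepsilon}$ has a $(q,t)$-linear solution. -/

import Mathlib

/-- A single-source multicast network: a directed acyclic multigraph with a source node, which
holds `numMessages` messages, and a set of receivers, each of which demands all the messages. -/
structure MulticastNetwork where
  Node : Type
  Link : Type
  tail : Link → Node
  head : Link → Node
  source : Node
  receivers : Set Node
  numMessages : ℕ
  acyclic : ∃ rank : Node → ℕ, ∀ e : Link, rank (tail e) < rank (head e)

namespace MulticastNetwork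

/-- The links that enter the node `v`. -/
def Incoming (N : MulticastNetwork) (v : N.Node) : Type :=
  {e : N.Link // N.head e = v}

/-- The tuples of source messages, each message being a vector in `F ^ t`. -/
abbrev Messages (N : MulticastNetwork) (F : Type*) (t : ℕ) : Type _ :=
  Fin N.numMessages → Fin t → F

/-- `N.HasLinearSolution F t`: the network has a `(q, t)`-linear solution over the field `F`
with `q` elements. Here `y e x` is the vector in `F ^ t` which the link `e` carries when the
source messages are `x`. A linear map between finite powers of `F ^ t` is the same as a block
matrix of `t × t` coding coefficients over `F`. -/
def HasLinearSolution (N : MulticastNetwork) (F : Type*) [Field F] (t : ℕ) : Prop :=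
  ∃ y : N.Link → N.Messages F t → (Fin t → F),
    -- the source transmits linear functions of the source messages
    (∀ e, N.tail e = N.source →
      ∃ A : N.Messages F t →ₗ[F] (Fin t → F), ∀ x, y e x = A x) ∧
    -- every other node transmits linear functions of its incoming vectors
    (∀ e, N.tail e ≠ N.source →
      ∃ C : (N.Incoming (N.tail e) → Fin t → F) →ₗ[F] (Fin t → F),
        ∀ x, y e x = C (fun e' => y e'.1 x)) ∧
    -- every receiver recovers all the source messages from its incoming vectors
    (∀ v ∈ N.receivers,
      ∃ D : (N.Incoming v → Fin t → F) →ₗ[F] N.Messages F t,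
        ∀ x, D (fun e' => y e'.1 x) = x)

end MulticastNetwork

namespace GeneralizedCombinationNetwork

/-- One receiver for each set of `α` middle nodes. -/
abbrev Receiver (r α : ℕ) : Type := {S : Finset (Fin r) // S.card = α}

/-- The source, the `r` middle nodes and the receivers. -/
inductive Node (r α : ℕ) : Type
  | source : Node r α
  | middle (i : Fin r) : Node r α
  | receiver (S : Receiver r α) : Node r α

/-- The links: `ℓ` parallel links from the source to each middle node, `ℓ` parallel links from
each middle node to each receiver it belongs to, and `ε` direct links from the source to each
receiver. -/
inductive Link (r α ℓ ε : ℕ) : Type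
  | toMiddle (i : Fin r) (k : Fin ℓ) : Link r α ℓ ε
  | toReceiver (S : Receiver r α) (i : Fin r) (hi : i ∈ S.1) (k : Fin ℓ) : Link r α ℓ ε
  | direct (S : Receiver r α) (k : Fin ε) : Link r α ℓ ε

/-- The node at which a link starts. -/
def Link.tail {r α ℓ ε : ℕ} : Link r α ℓ ε → Node r α
  | .toMiddle _ _ => .source
  | .toReceiver _ i _ _ => .middle i
  | .direct _ _ => .source

/-- The node at which a link ends. -/
def Link.head {r α ℓ ε : ℕ} : Link r α ℓ ε → Node r α
  | .toMiddle i _ => .middle i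
  | .toReceiver S _ _ _ => .receiver S
  | .direct S _ => .receiver S

/-- The layer of a node. -/
def Node.layer {r α : ℕ} : Node r α → ℕ
  | .source => 0
  | .middle _ => 1
  | .receiver _ => 2

theorem Link.layer_tail_lt_layer_head {r α ℓ ε : ℕ} (e : Link r α ℓ ε) :
    e.tail.layer < e.head.layer := by
  cases e <;> simp [Link.tail, Link.head, Node.layer]

end GeneralizedCombinationNetwork

/-- The `(ε, ℓ)-N_{h, r, αℓ+ε}` generalized combination network. -/
def generalizedCombinationNetwork (ε ℓ h r α : ℕ) : MulticastNetwork where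
  Node := GeneralizedCombinationNetwork.Node r α
  Link := GeneralizedCombinationNetwork.Link r α ℓ ε
  tail := GeneralizedCombinationNetwork.Link.tail
  head := GeneralizedCombinationNetwork.Link.head
  source := .source
  receivers := Set.range .receiver
  numMessages := h
  acyclic := ⟨GeneralizedCombinationNetwork.Node.layer,
    GeneralizedCombinationNetwork.Link.layer_tail_lt_layer_head⟩

/-- The exponent `g(t) = max{ℓt, (h-ℓ)t} · (min{ℓt, (h-ℓ)t} - (h-ℓ-ε)t + 1)`, computed in `ℤ`
so that the subtractions are genuine. -/
def middleLayerExponent (ℓ ε h t : ℕ) : ℤ :=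
  max ((ℓ : ℤ) * t) (((h : ℤ) - ℓ) * t) *
    (min ((ℓ : ℤ) * t) (((h : ℤ) - ℓ) * t) - ((h : ℤ) - ℓ - ε) * t + 1)

/-! If middle node `i` receives `A i x`, a receiver for `S` misses only the common kernel of the `A
i`, `i ∈ S`; its direct links can repair this once that kernel has dimension at most `ε * t`. Split
the messages into `(p, q)` with `ℓ * t` and `(h - ℓ) * t` coordinates, and let node `i` receive `p +
U_i q`. Two nodes with distinct matrices lose only `ker (U_i - U_j)`, so it suffices that
differences of distinct matrices have rank at least `(h - ℓ - ε) * t`. Gabidulin codes, transposed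
if necessary, supply `q ^ g(t)` such matrices. Giving each to at most `α - 1` nodes forces two
distinct ones among any `α` nodes. -/

open Module Polynomial in
/-- A nonzero linearized polynomial of `q`-degree less than `k` has a kernel of dimension less
than `k`. -/
theorem finrank_ker_linearized_lt {F K : Type*} [Field F] [Fintype F] [Field K] [Algebra F K]
    [FiniteDimensional F K] {k : ℕ} {a : Fin k → K} (ha : a ≠ 0) {f : K →ₗ[F] K}
    (hf : ∀ x, f x = ∑ i, a i * x ^ Fintype.card F ^ (i : ℕ)) :
    finrank F (LinearMap.ker f) < k := by
  classical
  set q := Fintype.card F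
  have hq : 1 < q := Fintype.one_lt_card
  have : Finite K := Module.finite_of_finite F
  let P : K[X] := ∑ i : Fin k, C (a i) * X ^ q ^ (i : ℕ)
  obtain ⟨j, hj⟩ := Function.ne_iff.1 ha
  have hcoeff : P.coeff (q ^ (j : ℕ)) = a j := by
    simp only [P, finsetSum_coeff, coeff_C_mul, coeff_X_pow]
    rw [Finset.sum_eq_single j]
    · simp
    · intro i _ hij
      rw [if_neg, mul_zero]
      exact fun h => hij (Fin.ext (Nat.pow_right_injective hq h).symm)
    · simp
  have hP : P ≠ 0 := fun h => hj (by rw [← hcoeff, h]; simp)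
  have hk : 0 < k := j.pos
  have hdeg : P.natDegree ≤ q ^ (k - 1) := by
    refine natDegree_sum_le_of_forall_le _ _ fun i _ => (natDegree_C_mul_X_pow_le _ _).trans ?_
    exact Nat.pow_le_pow_right hq.le (by omega)
  -- The kernel has `q ^ dim` elements, all roots of `P`, whose degree is at most `q ^ (k - 1)`.
  have hsub : (LinearMap.ker f : Set K) ⊆ P.roots.toFinset := by
    intro x hx
    have h0 : f x = 0 := hx
    rw [hf] at h0
    simp [hP, P, IsRoot, eval_finsetSum, h0]
  have hcard : Nat.card (LinearMap.ker f) ≤ q ^ (k - 1) := by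
    calc Nat.card (LinearMap.ker f) = (LinearMap.ker f : Set K).ncard := rfl
      _ ≤ (P.roots.toFinset : Set K).ncard := Set.ncard_le_ncard hsub
      _ = P.roots.toFinset.card := Set.ncard_coe_finset _
      _ ≤ P.roots.card := Multiset.toFinset_card_le _
      _ ≤ q ^ (k - 1) := (card_roots' P).trans hdeg
  rw [Module.natCard_eq_pow_finrank (K := F), Nat.card_eq_fintype_card] at hcard
  have := (Nat.pow_le_pow_iff_right hq).1 hcard
  omega

open Module in
/-- Gabidulin codes: `q ^ (m * k)` matrices of size `m × n`, where `n ≤ m`, whose pairwise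
differences have rank greater than `n - k`. -/
theorem exists_gabidulin_code (F : Type*) [Field F] [Fintype F] {m n : ℕ} (k : ℕ) (hm : 0 < m)
    (hnm : n ≤ m) :
    ∃ c : Fin (Fintype.card F ^ (m * k)) → Matrix (Fin m) (Fin n) F,
      ∀ a b, a ≠ b → n < (c a - c b).rank + k := by
  obtain ⟨p, hp⟩ := CharP.exists F
  have : Fact p.Prime := ⟨CharP.char_is_prime F p⟩
  have : NeZero m := ⟨hm.ne'⟩
  -- Codewords are the `q`-polynomials on the degree `m` extension, restricted to an `n`-dimensional
  -- `F`-subspace, the image of `ι`.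
  let K := FiniteField.Extension F p m
  have hK : finrank F K = m := FiniteField.finrank_extension F p m
  let e : K ≃ₗ[F] (Fin m → F) := LinearEquiv.ofFinrankEq _ _ (by simp [hK])
  obtain ⟨ι, hι⟩ := (finrank_le_iff_exists_linearMap (R := F) (M := Fin n → F) (M' := K)).1
    (by simpa [hK] using hnm)
  have hcard : Nat.card (Fin k → K) = Fintype.card F ^ (m * k) := by
    rw [Nat.card_fun, FiniteField.natCard_extension, Nat.card_eq_fintype_card, ← pow_mul]
    simp
  let w : Fin (Fintype.card F ^ (m * k)) ≃ (Fin k → K) :=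
    (finCongr hcard.symm).trans (Finite.equivFin _).symm
  let L : (Fin k → K) → (K →ₗ[F] K) := fun a =>
    ∑ i, a i • ((FiniteField.frobeniusAlgHom F K) ^ (i : ℕ)).toLinearMap
  have hL : ∀ a x, L a x = ∑ i, a i * x ^ Fintype.card F ^ (i : ℕ) := by
    intro a x
    simp [L, AlgHom.coe_pow, FiniteField.coe_frobeniusAlgHom, pow_iterate]
  refine ⟨fun a => LinearMap.toMatrix' (e.toLinearMap ∘ₗ L (w a) ∘ₗ ι), fun a b hab => ?_⟩
  have hne : w a - w b ≠ 0 := sub_ne_zero.2 (w.injective.ne hab)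
  have hsub : e.toLinearMap ∘ₗ L (w a) ∘ₗ ι - e.toLinearMap ∘ₗ L (w b) ∘ₗ ι
      = e.toLinearMap ∘ₗ L (w a - w b) ∘ₗ ι := by
    refine LinearMap.ext fun x => ?_
    simp [hL, sub_mul, Finset.sum_sub_distrib]
  rw [← map_sub, hsub, Matrix.rank, ← Matrix.toLin'_apply', Matrix.toLin'_toMatrix']
  have hker := finrank_ker_linearized_lt hne (hL (w a - w b))
  have hle : finrank F (LinearMap.ker (e.toLinearMap ∘ₗ L (w a - w b) ∘ₗ ι))
      ≤ finrank F (LinearMap.ker (L (w a - w b))) := by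
    refine LinearMap.finrank_le_finrank_of_injective
      (f := ι.restrict (p := LinearMap.ker (e.toLinearMap ∘ₗ L (w a - w b) ∘ₗ ι))
        (q := LinearMap.ker (L (w a - w b))) fun x hx => by simpa using hx) ?_
    intro x y hxy
    exact Subtype.ext (hι (congrArg Subtype.val hxy))
  have := LinearMap.finrank_range_add_finrank_ker (e.toLinearMap ∘ₗ L (w a - w b) ∘ₗ ι)
  rw [finrank_fin_fun] at this
  omega

/-- Maximum rank distance codes of either shape. -/
theorem exists_mrd_code (F : Type*) [Field F] [Fintype F] {m n : ℕ} (k : ℕ) (h : 0 < max m n) :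
    ∃ c : Fin (Fintype.card F ^ (max m n * k)) → Matrix (Fin m) (Fin n) F,
      ∀ a b, a ≠ b → min m n < (c a - c b).rank + k := by
  rcases le_total n m with hnm | hmn
  · rw [max_eq_left hnm] at *
    rw [min_eq_right hnm]
    exact exists_gabidulin_code F k h hnm
  · rw [max_eq_right hmn] at *
    rw [min_eq_left hmn]
    obtain ⟨c, hc⟩ := exists_gabidulin_code F k h hmn
    refine ⟨fun a => (c a).transpose, fun a b hab => ?_⟩
    rw [← Matrix.transpose_sub, Matrix.rank_transpose]
    exact hc a b hab

open Module in
theorem exists_linearMap_finrank_ker_le {F V W : Type*} [Field F] [AddCommGroup V] [Module F V]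
    [FiniteDimensional F V] [AddCommGroup W] [Module F W] [FiniteDimensional F W] {n : ℕ}
    (h : finrank F V ≤ finrank F W + n) :
    ∃ f : V →ₗ[F] W, finrank F (LinearMap.ker f) ≤ n := by
  rcases le_total (finrank F V) (finrank F W) with hle | hle
  · obtain ⟨f, hf⟩ := finrank_le_iff_exists_linearMap.1 hle
    exact ⟨f, by rw [LinearMap.ker_eq_bot.2 hf, finrank_bot]; exact n.zero_le⟩
  · obtain ⟨g, hg⟩ := finrank_le_iff_exists_linearMap.1 hle
    obtain ⟨f, hf⟩ := g.exists_leftInverse_of_injective (LinearMap.ker_eq_bot.2 hg)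
    have hr : LinearMap.range f = ⊤ :=
      LinearMap.range_eq_top.2 fun y => ⟨g y, LinearMap.congr_fun hf y⟩
    have := f.finrank_range_add_finrank_ker
    rw [hr, finrank_top] at this
    exact ⟨f, by omega⟩

-- Supplies the direct links: `p` is what the middle nodes leave undetermined, and `f` must be
-- injective on it.
open Module in
theorem exists_linearMap_disjoint_ker {F V W : Type*} [Field F] [AddCommGroup V] [Module F V]
    [AddCommGroup W] [Module F W] [FiniteDimensional F W] (p : Submodule F V)
    [FiniteDimensional F p] (h : finrank F p ≤ finrank F W) :
    ∃ f : V →ₗ[F] W, Disjoint p (LinearMap.ker f) := by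
  obtain ⟨g, hg⟩ := finrank_le_iff_exists_linearMap.1 h
  obtain ⟨f, hf⟩ := LinearMap.exists_extend g
  refine ⟨f, Submodule.disjoint_def.2 fun x hx hfx => ?_⟩
  have h1 : g ⟨x, hx⟩ = g 0 := by
    rw [← hf, map_zero]
    exact hfx
  exact congrArg Subtype.val (hg h1)

open Module in
/-- Two encodings `(p, q) ↦ p + U q` and `(p, q) ↦ p + U' q` jointly determine `(p, q)` up to
the kernel of `U - U'`. -/
theorem finrank_ker_inf_ker_coprod_le {F P Q : Type*} [Field F] [AddCommGroup P] [Module F P]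
    [AddCommGroup Q] [Module F Q] [FiniteDimensional F Q] (U U' : Q →ₗ[F] P) :
    finrank F ↥(LinearMap.ker (LinearMap.id.coprod U) ⊓ LinearMap.ker (LinearMap.id.coprod U'))
      ≤ finrank F (LinearMap.ker (U - U')) := by
  refine LinearMap.finrank_le_finrank_of_injective
    (f := (LinearMap.snd F P Q).restrict (q := LinearMap.ker (U - U')) fun x hx => ?_) ?_
  · have h1 : x.1 + U x.2 = 0 := by simpa using hx.1
    have h2 : x.1 + U' x.2 = 0 := by simpa using hx.2
    have h3 : U x.2 = U' x.2 := add_left_cancel (h1.trans h2.symm)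
    simpa [sub_eq_zero] using h3
  · rintro ⟨x, hx⟩ ⟨y, hy⟩ hxy
    have h2 : x.2 = y.2 := congrArg Subtype.val hxy
    have hx1 : x.1 + U x.2 = 0 := by simpa using hx.1
    have hy1 : y.1 + U y.2 = 0 := by simpa using hy.1
    rw [h2] at hx1
    exact Subtype.ext (Prod.ext (add_right_cancel (hx1.trans hy1.symm)) h2)

open Module in
/-- If the maps at the middle nodes of each receiver lose at most `ε * t` dimensions together,
then the direct links can be chosen so that all receivers decode. -/
theorem hasLinearSolution_of_finrank_iInf_ker_le {ε ℓ h r α t : ℕ} {F : Type*} [Field F]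
    (A : Fin r → ((Fin h → Fin t → F) →ₗ[F] (Fin ℓ → Fin t → F)))
    (hA : ∀ S : Finset (Fin r), S.card = α →
      finrank F ↥(⨅ i ∈ S, LinearMap.ker (A i)) ≤ ε * t) :
    (generalizedCombinationNetwork ε ℓ h r α).HasLinearSolution F t := by
  have hB : ∀ S : GeneralizedCombinationNetwork.Receiver r α,
      ∃ B : (Fin h → Fin t → F) →ₗ[F] (Fin ε → Fin t → F),
        Disjoint (⨅ i ∈ S.1, LinearMap.ker (A i)) (LinearMap.ker B) := fun S =>
    exists_linearMap_disjoint_ker _ (by simpa [finrank_pi_fintype] using hA S.1 S.2)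
  choose B hB using hB
  -- Middle nodes merely forward their `ℓ` incoming vectors.
  let Y : GeneralizedCombinationNetwork.Link r α ℓ ε →
      ((Fin h → Fin t → F) →ₗ[F] (Fin t → F)) := fun e => match e with
    | .toMiddle i k => LinearMap.proj k ∘ₗ A i
    | .toReceiver _ i _ k => LinearMap.proj k ∘ₗ A i
    | .direct S k => LinearMap.proj k ∘ₗ B S
  refine ⟨fun e => Y e, fun e _ => ⟨Y e, fun _ => rfl⟩, ?_, ?_⟩
  · rintro (⟨i, k⟩ | ⟨S, i, hi, k⟩ | ⟨S, k⟩) he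
    · exact absurd rfl he
    · exact ⟨LinearMap.proj ⟨.toMiddle i k, rfl⟩, fun _ => rfl⟩
    · exact absurd rfl he
  · rintro _ ⟨S, rfl⟩
    let I := (generalizedCombinationNetwork ε ℓ h r α).Incoming (.receiver S)
    let T : (Fin h → Fin t → F) →ₗ[F] (I → Fin t → F) := LinearMap.pi fun e : I => Y e.1
    have hT : LinearMap.ker T = ⊥ := by
      refine (Submodule.eq_bot_iff _).2 fun x hx => ?_
      have hx' : ∀ e : I, Y e.1 x = 0 := fun e => congrFun (LinearMap.mem_ker.1 hx) e
      refine Submodule.disjoint_def.1 (hB S) x ?_ ?_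
      · simp only [Submodule.mem_iInf, LinearMap.mem_ker]
        intro i hi
        funext k
        exact hx' ⟨.toReceiver S i hi k, rfl⟩
      · rw [LinearMap.mem_ker]
        funext k
        exact hx' ⟨.direct S k, rfl⟩
    obtain ⟨D, hD⟩ := T.exists_leftInverse_of_injective hT
    exact ⟨D, fun x => LinearMap.congr_fun hD x⟩

/-- An assignment of `r ≤ (α - 1) * n` nodes to `n` classes without `α` nodes in one class. -/
theorem exists_map_forall_card_eq_exists_ne {r n α : ℕ} (hα : 1 ≤ α) (hr : r ≤ (α - 1) * n) :
    ∃ φ : Fin r → Fin n, ∀ S : Finset (Fin r), S.card = α →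
      ∃ i ∈ S, ∃ j ∈ S, φ i ≠ φ j := by
  -- With nodes placed in distinct cells of a grid, a class is a column of only `α - 1` cells.
  obtain ⟨ψ⟩ : Nonempty (Fin r ↪ Fin n × Fin (α - 1)) :=
    Function.Embedding.nonempty_of_card_le (by simpa [mul_comm n] using hr)
  refine ⟨fun i => (ψ i).1, fun S hS => ?_⟩
  by_contra! hcon
  have hcard : S.card ≤ (Finset.univ : Finset (Fin (α - 1))).card :=
    Finset.card_le_card_of_injOn (fun i => (ψ i).2) (by simp)
      fun i hi j hj hij => ψ.injective (Prod.ext (hcon i hi j hj) hij)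
  rw [Finset.card_univ, Fintype.card_fin] at hcard
  omega

theorem middleLayerExponent_eq (ℓ ε h t : ℕ) :
    middleLayerExponent ℓ ε h t =
      if h ≤ 2 * ℓ then (ℓ : ℤ) * ε * (t : ℤ) ^ 2 + (ℓ : ℤ) * t
      else ((h : ℤ) - ℓ) * (2 * (ℓ : ℤ) + ε - h) * (t : ℤ) ^ 2 + ((h : ℤ) - ℓ) * t := by
  unfold middleLayerExponent
  split_ifs with hc
  · have : ((h : ℤ) - ℓ) * t ≤ (ℓ : ℤ) * t :=
      mul_le_mul_of_nonneg_right (by omega) (by positivity)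
    rw [max_eq_left this, min_eq_right this]
    ring
  · have : (ℓ : ℤ) * t ≤ ((h : ℤ) - ℓ) * t :=
      mul_le_mul_of_nonneg_right (by omega) (by positivity)
    rw [max_eq_right this, min_eq_left this]
    ring

open Module in
/-- The case in which any single middle node, together with the direct links, can carry all the
messages. -/
theorem hasLinearSolution_of_le_add {ε ℓ h α t : ℕ} (r : ℕ) (F : Type*) [Field F] (hα : 1 ≤ α)
    (hle : h ≤ ℓ + ε) : (generalizedCombinationNetwork ε ℓ h r α).HasLinearSolution F t := by
  obtain ⟨f, hf⟩ := exists_linearMap_finrank_ker_le (F := F) (V := Fin h → Fin t → F)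
    (W := Fin ℓ → Fin t → F) (n := ε * t)
    (by simpa [finrank_pi_fintype, ← add_mul] using Nat.mul_le_mul_right t hle)
  refine hasLinearSolution_of_finrank_iInf_ker_le (fun _ => f) fun S hS => ?_
  obtain ⟨i, hi⟩ := Finset.card_pos.1 (by omega : 0 < S.card)
  exact (Submodule.finrank_mono (iInf₂_le i hi)).trans hf

open Module in
/-- The case in which the middle nodes use distinct codewords of a rank metric code. -/
theorem hasLinearSolution_of_le_pow {ε ℓ s α t r k : ℕ} (F : Type*) [Field F] [Fintype F]
    (hα : 1 ≤ α) (hℓ : 0 < ℓ * t) (hk : k + s * t = min (ℓ * t) (s * t) + ε * t + 1)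
    (hr : r ≤ (α - 1) * Fintype.card F ^ (max (ℓ * t) (s * t) * k)) :
    (generalizedCombinationNetwork ε ℓ (ℓ + s) r α).HasLinearSolution F t := by
  obtain ⟨c, hc⟩ := exists_mrd_code F k (lt_max_of_lt_left hℓ : 0 < max (ℓ * t) (s * t))
  obtain ⟨φ, hφ⟩ := exists_map_forall_card_eq_exists_ne hα hr
  let e : (Fin (ℓ + s) → Fin t → F) ≃ₗ[F] (Fin (ℓ * t) → F) × (Fin (s * t) → F) :=
    LinearEquiv.ofFinrankEq _ _ (by simp [finrank_pi_fintype, add_mul])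
  let e' : (Fin (ℓ * t) → F) ≃ₗ[F] (Fin ℓ → Fin t → F) :=
    LinearEquiv.ofFinrankEq _ _ (by simp [finrank_pi_fintype])
  let A : Fin r → ((Fin (ℓ + s) → Fin t → F) →ₗ[F] (Fin ℓ → Fin t → F)) := fun i =>
    e'.toLinearMap ∘ₗ (LinearMap.id.coprod (c (φ i)).mulVecLin) ∘ₗ e.toLinearMap
  refine hasLinearSolution_of_finrank_iInf_ker_le A fun S hS => ?_
  obtain ⟨i, hi, j, hj, hij⟩ := hφ S hS
  have hrank := hc _ _ hij
  have hle : finrank F ↥(⨅ i ∈ S, LinearMap.ker (A i)) ≤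
      finrank F ↥(LinearMap.ker (LinearMap.id.coprod (c (φ i)).mulVecLin) ⊓
        LinearMap.ker (LinearMap.id.coprod (c (φ j)).mulVecLin)) := by
    refine LinearMap.finrank_le_finrank_of_injective
      (f := e.toLinearMap.restrict fun x hx => ?_) ?_
    · simp only [Submodule.mem_iInf] at hx
      exact ⟨by simpa [A] using hx i hi, by simpa [A] using hx j hj⟩
    · intro x y hxy
      exact Subtype.ext (e.injective (congrArg Subtype.val hxy))
  have hker := finrank_ker_inf_ker_coprod_le (c (φ i)).mulVecLin (c (φ j)).mulVecLin
  have hdim := LinearMap.finrank_range_add_finrank_ker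
    ((c (φ i)).mulVecLin - (c (φ j)).mulVecLin)
  have hsub : (c (φ i)).mulVecLin - (c (φ j)).mulVecLin = (c (φ i) - c (φ j)).mulVecLin := by
    ext x : 1
    simp
  rw [finrank_fin_fun, hsub] at hdim
  rw [hsub] at hker
  rw [Matrix.rank] at hrank
  -- The kernel has dimension `s * t - rank < s * t - min + k = ε * t + 1`.
  omega

theorem mainTheorem6 (α h ℓ t ε r q : ℕ) (hα : 2 ≤ α) (hh : 1 ≤ h) (hℓ : 1 ≤ ℓ) (ht : 1 ≤ t)
    (hle : h ≤ 2 * ℓ + ε) (F : Type*) [Field F] [Fintype F] (hq : Fintype.card F = q) :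
    middleLayerExponent ℓ ε h t =
        (if h ≤ 2 * ℓ then (ℓ : ℤ) * ε * (t : ℤ) ^ 2 + (ℓ : ℤ) * t
          else ((h : ℤ) - ℓ) * (2 * (ℓ : ℤ) + ε - h) * (t : ℤ) ^ 2 + ((h : ℤ) - ℓ) * t) ∧
      ((r : ℝ) ≤ ((α : ℝ) - 1) * (q : ℝ) ^ middleLayerExponent ℓ ε h t →
        (generalizedCombinationNetwork ε ℓ h r α).HasLinearSolution F t) := by
  refine ⟨middleLayerExponent_eq ℓ ε h t, fun hr => ?_⟩
  rcases le_or_gt h (ℓ + ε) with hcase | hcase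
  -- No bound on `r` is needed here, and what remains has `ℓ < h`, so `h - ℓ` is a natural number
  -- `s`.
  · exact hasLinearSolution_of_le_add r F (by omega) hcase
  obtain ⟨s, rfl⟩ := Nat.exists_eq_add_of_le (by omega : ℓ ≤ h)
  -- The hypothesis `h ≤ 2 * ℓ + ε` enters here: it makes the second factor of `g(t)` a natural
  -- number `k`, the number of coefficients of the code's `q`-polynomials.
  have hs : s * t ≤ min (ℓ * t) (s * t) + ε * t := by
    rw [← min_add_add_right, le_min_iff, ← add_mul]
    exact ⟨Nat.mul_le_mul_right t (by omega), Nat.le_add_right _ _⟩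
  obtain ⟨k, hk⟩ := Nat.exists_eq_add_of_le (hs.trans (Nat.le_succ _))
  have hexp : middleLayerExponent ℓ ε (ℓ + s) t = ((max (ℓ * t) (s * t) * k : ℕ) : ℤ) := by
    have hk' : ((min (ℓ * t) (s * t) + ε * t + 1 : ℕ) : ℤ) = ((s * t + k : ℕ) : ℤ) :=
      congrArg _ hk
    push_cast at hk'
    unfold middleLayerExponent
    push_cast
    rw [add_sub_cancel_left]
    congr 1
    linarith
  rw [hexp, zpow_natCast] at hr
  refine hasLinearSolution_of_le_pow F (by omega) (Nat.mul_pos hℓ ht) (k := k) (by omega) ?_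
  rw [hq]
  have h1 : ((α - 1 : ℕ) : ℝ) = (α : ℝ) - 1 := by
    rw [Nat.cast_sub (by omega), Nat.cast_one]
  rw [← h1] at hr
  exact_mod_cast hr
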